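/- Let $p>1$ be a real number and let $X$ be a locally compact, noncompact, complete metric space with a Borel measure $\mu$ such that $0<\mu(B)<\infty$ for every open ball $B$ of positive radius, $\mu$ is doubling (there is a constant $C$ with $\mu(B_{2r}(x))\le C\mu(B_r(x))$ for all $x\in X$, $r>0$), and $X$ satisfies a $(1,p)$-Poincaré inequality: there are $C>0$, $\sigma\ge 1$ such that \[ \frac1{\mu(B_r(x))}\int_{B_r(x)}|u-u_{B_r(x)}|\,d\mu\le Cr\Big(\frac1{\mu(B_{\sigma r}(x))}\int_{B_{\sigma r}(x)}g^p\,d\mu\Big)^{1/p} \] for all $x\in X$, $r>0$, all Borel functions $u\in \mathcal L^p_{loc}(X)$ and all $p$-weak upper gradients $g$ of $u$, where $u_{B_r(x)}$ is the mean value of $u$ on $B_r(x)$. Here a Borel function $g:X\to[0,\infty]$ is a $p$-weak upper gradient of $u:X\to\mathbb R$ if the family $\Gamma$ of those rectifiable curves $\gamma:[a,b]\to X$ for which $|u(\gamma(b))-u(\gamma(a))|\le\int_\gamma g\,ds$ fails has $p$-modulus zero, i.e. $\inf_\rho\int_X\rho^p\,d\mu=0$, the infimum being over all Borel $\rho:X\to[0,\infty]$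 with $\int_\gamma\rho\,ds\ge1$ for all $\gamma\in\Gamma$. A minimal $p$-weak upper gradient $|\nabla u|$ of $u$ is a $p$-weak upper gradient of $u$ in $L^p(X)$ with $|\nabla u|\le g$ a.e. for every $p$-weak upper gradient $g\in L^p(X)$ of $u$. Let $BD^p(X)$ be the set of bounded continuous functions $u:X\to\mathbb R$ with a minimal $p$-weak upper gradient in $L^p(X)$, and $BD^p_c(X)$ the set of those with compact support. A sequence $(u_n)$ converges to $u$ in the $BD^p$-topology if it is uniformly bounded, converges to $u$ uniformly on compact sets, and $\int_X|\nabla(u_n-u)|^p\,d\mu\to0$. Let $\overline{BD^p_c(X)}_{BD^p}$ be the set of all limits, in this sense, of sequences in $BD^p_c(X)$. The space $X$ is called $p$-parabolic if the constant function $1_X$ belongs to $\overline{BD^p_c(X)}_{BD^p}$. For $u\in BD^p(X)$ let $I_u=[\inf u,\sup u]$, let $Y=\prod_{u\in BD^p(X)}I_u$ with the product topology, let $e:X\to Y$, $e(x)(u)=u(x)$, and let $\overline X$ be the closure of $e(X)$ in $Y$. The $p$-Royden boundary is $R_p(X)=\overline X\setminus e(X)$, and the $p$-harmonic boundary is \[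 \Delta_p(X)=\{x\in R_p(X) : x(u)=0\text{ for all }u\in\overline{BD^p_c(X)}_{BD^p}\cap BD^p(X)\}. \] Then $X$ is $p$-parabolic if and only if $\Delta_p(X)=\emptyset$. -/

import Mathlib

open MeasureTheory Set Filter Topology
open scoped ENNReal NNReal

namespace PRoyden

/-- A (compact) rectifiable curve `γ : [a, b] → X`: a continuous map of finite length.  Only the
values on `[a, b]` are ever used. -/
structure RectifiableCurve (X : Type*) [MetricSpace X] where
  toFun : ℝ → X
  a : ℝ
  b : ℝ
  le : a ≤ b
  continuousOn : ContinuousOn toFun (Icc a b)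
  rectifiable : eVariationOn toFun (Icc a b) ≠ ∞

/-- The length of a rectifiable curve. -/
noncomputable def RectifiableCurve.length {X : Type*} [MetricSpace X]
    (γ : RectifiableCurve X) : ℝ :=
  (eVariationOn γ.toFun (Icc γ.a γ.b)).toReal

/-- The line integral `∫_γ ρ ds`, computed in the arc length parametrization of `γ`. -/
noncomputable def RectifiableCurve.lineIntegral {X : Type*} [MetricSpace X]
    (γ : RectifiableCurve X) (ρ : X → ℝ≥0∞) : ℝ≥0∞ :=
  ∫⁻ s in Icc 0 γ.length, ρ (naturalParameterization γ.toFun (Icc γ.a γ.b) γ.a s)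

section Gradients

variable {X : Type*} [MetricSpace X] [MeasurableSpace X]

/-- The Borel functions `ρ : X → [0, ∞]` with `∫_γ ρ ds ≥ 1` for every `γ ∈ Γ`. -/
def admissible (Γ : Set (RectifiableCurve X)) : Set (X → ℝ≥0∞) :=
  {ρ | Measurable ρ ∧ ∀ γ ∈ Γ, 1 ≤ γ.lineIntegral ρ}

/-- The `p`-modulus of a family of curves. -/
noncomputable def modulus (p : ℝ) (μ : Measure X) (Γ : Set (RectifiableCurve X)) : ℝ≥0∞ :=
  ⨅ ρ ∈ admissible Γ, ∫⁻ x, ρ x ^ p ∂μ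

/-- The upper gradient inequality `|u(γ(b)) - u(γ(a))| ≤ ∫_γ g ds` along the curve `γ`. -/
def UpperGradientIneq (u : X → ℝ) (g : X → ℝ≥0∞) (γ : RectifiableCurve X) : Prop :=
  ENNReal.ofReal |u (γ.toFun γ.b) - u (γ.toFun γ.a)| ≤ γ.lineIntegral g

/-- `g` is a `p`-weak upper gradient of `u`: a Borel function `X → [0, ∞]` satisfying the upper
gradient inequality along `p`-almost every curve. -/
def IsWeakUpperGradient (p : ℝ) (μ : Measure X) (u : X → ℝ) (g : X → ℝ≥0∞) : Prop :=
  Measurable g ∧ modulus p μ {γ | ¬ UpperGradientIneq u g γ} = 0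

/-- `g = |∇u|` is a minimal `p`-weak upper gradient of `u` in `L^p`: it is a `p`-integrable `p`-weak
upper gradient and it is a.e. at most any other `p`-integrable `p`-weak upper gradient of `u`. -/
def IsMinimalWeakUpperGradient (p : ℝ) (μ : Measure X) (u : X → ℝ) (g : X → ℝ≥0∞) : Prop :=
  IsWeakUpperGradient p μ u g ∧ ∫⁻ x, g x ^ p ∂μ < ∞ ∧
    ∀ g₁ : X → ℝ≥0∞, IsWeakUpperGradient p μ u g₁ → ∫⁻ x, g₁ x ^ p ∂μ < ∞ → g ≤ᵐ[μ] g₁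

/-- The measure is doubling (at all scales). -/
def IsDoubling (μ : Measure X) : Prop :=
  ∃ C : ℝ≥0, ∀ (x : X) (r : ℝ), 0 < r →
    μ (Metric.ball x (2 * r)) ≤ C * μ (Metric.ball x r)

/-- The `(q, p)`-Poincaré inequality, for all Borel functions `u` in `L^p_loc(X)` and all `p`-weak
upper gradients `g` of `u`. -/
def PoincareInequality (q p : ℝ) (μ : Measure X) : Prop :=
  ∃ C σ : ℝ, 0 < C ∧ 1 ≤ σ ∧
    ∀ (u : X → ℝ) (g : X → ℝ≥0∞), Measurable u →
      (∀ K : Set X, IsCompact K → MemLp u (ENNReal.ofReal p) (μ.restrict K)) →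
      IsWeakUpperGradient p μ u g →
      ∀ (x : X) (r : ℝ), 0 < r →
        (⨍⁻ y in Metric.ball x r, ‖u y - ⨍ z in Metric.ball x r, u z ∂μ‖ₑ ^ q ∂μ) ^ (1 / q) ≤
          ENNReal.ofReal (r * C) *
            (⨍⁻ y in Metric.ball x (σ * r), g y ^ p ∂μ) ^ (1 / p)

/-- The `p`-Royden algebra `BD^p(X)`: bounded continuous functions having a minimal `p`-weak upper
gradient in `L^p`. -/
def BD (p : ℝ) (μ : Measure X) : Set (X → ℝ) :=
  {u | Continuous u ∧ (∃ M : ℝ, ∀ x, |u x| ≤ M) ∧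
    ∃ g : X → ℝ≥0∞, IsMinimalWeakUpperGradient p μ u g}

/-- The functions in `BD^p(X)` with compact support. -/
def BDc (p : ℝ) (μ : Measure X) : Set (X → ℝ) :=
  {u | u ∈ BD p μ ∧ HasCompactSupport u}

/-- Convergence of a sequence `v n → u` in the `BD^p`-topology: uniform boundedness of the sequence,
uniform convergence on compact sets, and `∫ |∇(v n - u)|^p dμ → 0`. -/
def BDConverges (p : ℝ) (μ : Measure X) (v : ℕ → X → ℝ) (u : X → ℝ) : Prop :=
  (∃ M : ℝ, ∀ n x, |v n x| ≤ M) ∧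
  (∀ K : Set X, IsCompact K → TendstoUniformlyOn v u atTop K) ∧
  ∃ g : ℕ → X → ℝ≥0∞,
    (∀ n, IsMinimalWeakUpperGradient p μ (fun x => v n x - u x) (g n)) ∧
    Tendsto (fun n => ∫⁻ x, g n x ^ p ∂μ) atTop (𝓝 0)

/-- The closure of the compactly supported functions of `BD^p(X)` in the `BD^p`-topology. -/
def BDcClosure (p : ℝ) (μ : Measure X) : Set (X → ℝ) :=
  {u | ∃ v : ℕ → X → ℝ, (∀ n, v n ∈ BDc p μ) ∧ BDConverges p μ v u}

/-- `X` is `p`-parabolic if the constant function one is in the `BD^p`-closure of `BD^p_c(X)`. -/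
def IsParabolic (p : ℝ) (μ : Measure X) : Prop :=
  (fun _ : X => (1 : ℝ)) ∈ BDcClosure p μ

/-- The product `Y` of the compact intervals `I_u = [inf u, sup u]`, over all `u ∈ BD^p(X)`, with
the product topology. -/
abbrev RoydenProduct (p : ℝ) (μ : Measure X) : Type _ :=
  ∀ u : BD p μ, Icc (⨅ x, u.1 x) (⨆ x, u.1 x)

theorem BD.apply_mem_Icc {p : ℝ} {μ : Measure X} (u : BD p μ) (x : X) :
    u.1 x ∈ Icc (⨅ y, u.1 y) (⨆ y, u.1 y) := by
  obtain ⟨M, hM⟩ := u.2.2.1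
  refine ⟨ciInf_le ⟨-M, ?_⟩ x, le_ciSup ⟨M, ?_⟩ x⟩
  · rintro _ ⟨y, rfl⟩
    exact (abs_le.1 (hM y)).1
  · rintro _ ⟨y, rfl⟩
    exact (abs_le.1 (hM y)).2

/-- The evaluation map `e : X → Y`, `e(x)(u) = u(x)`. -/
noncomputable def evalMap (p : ℝ) (μ : Measure X) (x : X) : RoydenProduct p μ :=
  fun u => ⟨u.1 x, BD.apply_mem_Icc u x⟩

/-- The `p`-Royden compactification: the closure of `e(X)` in `Y`. -/
def roydenCompactification (p : ℝ) (μ : Measure X) : Set (RoydenProduct p μ) :=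
  closure (range (evalMap p μ))

/-- The `p`-Royden boundary `R_p(X)`. -/
def roydenBoundary (p : ℝ) (μ : Measure X) : Set (RoydenProduct p μ) :=
  roydenCompactification p μ \ range (evalMap p μ)

/-- The `p`-harmonic boundary `Δ_p(X)`: the points of the `p`-Royden boundary at which every
function in the `BD^p`-closure of `BD^p_c(X)` vanishes. -/
def harmonicBoundary (p : ℝ) (μ : Measure X) : Set (RoydenProduct p μ) :=
  {z | z ∈ roydenBoundary p μ ∧ ∀ u : BD p μ, u.1 ∈ BDcClosure p μ → (z u : ℝ) = 0}

end Gradients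

end PRoyden

/-! If $1_X$ lies in the closure, a harmonic boundary point would have coordinate $0$ at $1_X$,
while $I_{1_X}=\{1\}$. Conversely, $\overline X$ is compact. If $\Delta_p(X)=\emptyset$, each point
of $\overline X$ has a function of $BD^p(X)\cap\overline{BD^p_c(X)}_{BD^p}$ that is nonzero there:
on the boundary by hypothesis, on $e(X)$ by a compactly supported cone. Finitely many suffice, and
the sum $w$ of their squares has a positive minimum on $\overline X$. Hence $1/w\in BD^p(X)$, and
$1=w\cdot(1/w)$ lies in the closure because multiplication by $BD^p(X)$ preserves it.

The analytic work is thus that $BD^p(X)$ is an algebra and that this ideal property holds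
(`BDcClosure.mul`). Both need a Leibniz rule for weak upper gradients: along $p$-almost every curve
a function with a $p$-integrable gradient $g$ is absolutely continuous in arc length with derivative
at most $g$ (`IsWeakUpperGradient.eventually_derivLE`), so ordinary calculus applies. By
`IsLpGradient.exists_isMinimalWeakUpperGradient` it is enough to exhibit some $p$-integrable
gradient. -/

namespace PRoyden

/-! ### Arc length parametrization and subcurves -/

section ArcLength

variable {X : Type*} [MetricSpace X]

/-- At a point of continuity of `f`, the variation over a shrinking one-sided interval tends to
zero, on the left and on the right. -/
theorem continuousOn_variationOnFromTo {f : ℝ → X} {a b : ℝ} (hab : a ≤ b)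
    (hf : ContinuousOn f (Icc a b)) (hv : BoundedVariationOn f (Icc a b)) :
    ContinuousOn (variationOnFromTo f (Icc a b) a) (Icc a b) := by
  intro x hx
  have ha : a ∈ Icc a b := left_mem_Icc.2 hab
  have h1 := hv.tendsto_eVariationOn_Icc_zero_right x ((hf x hx).mono inter_subset_left)
  have h2 := hv.tendsto_eVariationOn_Icc_zero_left ((hf x hx).mono inter_subset_left)
  have h := (ENNReal.tendsto_toReal ENNReal.zero_ne_top).comp
    ((h1.add h2).mono_right (by rw [add_zero]))
  rw [ContinuousWithinAt, tendsto_iff_dist_tendsto_zero]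
  refine squeeze_zero' (.of_forall fun _ => dist_nonneg) ?_ h
  filter_upwards [self_mem_nhdsWithin] with y hy
  have hadd := variationOnFromTo.add hv.locallyBoundedVariationOn ha hx hy
  have hfin (u v : ℝ) : eVariationOn f (Icc a b ∩ Icc u v) ≠ ∞ := hv.mono inter_subset_left
  rw [Real.dist_eq, ← hadd, add_sub_cancel_left, Function.comp_apply,
    ENNReal.toReal_add (hfin _ _) (hfin _ _)]
  rcases le_total x y with h | h
  · rw [variationOnFromTo.eq_of_le _ _ h, abs_of_nonneg ENNReal.toReal_nonneg]
    exact le_add_of_nonneg_right ENNReal.toReal_nonneg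
  · rw [variationOnFromTo.eq_of_ge _ _ h, abs_neg, abs_of_nonneg ENNReal.toReal_nonneg]
    exact le_add_of_nonneg_left ENNReal.toReal_nonneg

namespace RectifiableCurve

variable (γ : RectifiableCurve X)

/-- The arc length parametrization of `γ`, of interest on `[0, length γ]`. -/
noncomputable def arc : ℝ → X :=
  naturalParameterization γ.toFun (Icc γ.a γ.b) γ.a

theorem boundedVariationOn : BoundedVariationOn γ.toFun (Icc γ.a γ.b) := γ.rectifiable

theorem length_nonneg : 0 ≤ γ.length := ENNReal.toReal_nonneg

theorem variationOnFromTo_right :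
    variationOnFromTo γ.toFun (Icc γ.a γ.b) γ.a γ.b = γ.length := by
  rw [variationOnFromTo.eq_of_le _ _ γ.le, inter_self, length]

/-- The natural parametrization has unit speed only on the range of the arc length function;
continuity and the intermediate value theorem make this range the full interval. -/
theorem image_variationOnFromTo :
    variationOnFromTo γ.toFun (Icc γ.a γ.b) γ.a '' Icc γ.a γ.b = Icc 0 γ.length := by
  have ha : γ.a ∈ Icc γ.a γ.b := left_mem_Icc.2 γ.le
  have hb : γ.b ∈ Icc γ.a γ.b := right_mem_Icc.2 γ.le
  have hm := variationOnFromTo.monotoneOn γ.boundedVariationOn.locallyBoundedVariationOn ha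
  refine Subset.antisymm ?_ ?_
  · rintro _ ⟨t, ht, rfl⟩
    refine ⟨variationOnFromTo.nonneg_of_le _ _ ht.1, ?_⟩
    rw [← γ.variationOnFromTo_right]
    exact hm ht hb ht.2
  · have := intermediate_value_Icc γ.le
      (continuousOn_variationOnFromTo γ.le γ.continuousOn γ.boundedVariationOn)
    rwa [variationOnFromTo.self, γ.variationOnFromTo_right] at this

theorem hasUnitSpeedOn_arc : HasUnitSpeedOn γ.arc (Icc 0 γ.length) := by
  rw [← γ.image_variationOnFromTo]
  exact has_unit_speed_naturalParameterization _
    γ.boundedVariationOn.locallyBoundedVariationOn (left_mem_Icc.2 γ.le)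

theorem arc_zero : γ.arc 0 = γ.toFun γ.a := by
  have ha : γ.a ∈ Icc γ.a γ.b := left_mem_Icc.2 γ.le
  have := edist_naturalParameterization_eq_zero
    γ.boundedVariationOn.locallyBoundedVariationOn ha ha
  rw [variationOnFromTo.self] at this
  exact edist_eq_zero.1 this

theorem arc_length : γ.arc γ.length = γ.toFun γ.b := by
  have := edist_naturalParameterization_eq_zero
    γ.boundedVariationOn.locallyBoundedVariationOn (left_mem_Icc.2 γ.le) (right_mem_Icc.2 γ.le)
  rw [variationOnFromTo_right] at this
  exact edist_eq_zero.1 this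

theorem eVariationOn_arc {s t : ℝ} (hs : 0 ≤ s) (hst : s ≤ t) (ht : t ≤ γ.length) :
    eVariationOn γ.arc (Icc s t) = ENNReal.ofReal (t - s) := by
  have h := γ.hasUnitSpeedOn_arc ⟨hs, hst.trans ht⟩ ⟨hs.trans hst, ht⟩
  rwa [inter_eq_right.2 (Icc_subset_Icc hs ht), NNReal.coe_one, one_mul] at h

theorem lipschitzOnWith_arc : LipschitzOnWith 1 γ.arc (Icc 0 γ.length) := by
  have key : ∀ x ∈ Icc 0 γ.length, ∀ y ∈ Icc 0 γ.length, x ≤ y →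
      edist (γ.arc x) (γ.arc y) ≤ edist x y := by
    intro x hx y hy hxy
    refine (eVariationOn.edist_le γ.arc (left_mem_Icc.2 hxy) (right_mem_Icc.2 hxy)).trans ?_
    rw [γ.eVariationOn_arc hx.1 hxy hy.2, edist_comm, edist_dist, Real.dist_eq]
    exact ENNReal.ofReal_le_ofReal (le_abs_self _)
  intro x hx y hy
  rw [ENNReal.coe_one, one_mul]
  rcases le_total x y with h | h
  · exact key x hx y hy h
  · rw [edist_comm, edist_comm x]
    exact key y hy x hx h

theorem continuousOn_arc : ContinuousOn γ.arc (Icc 0 γ.length) :=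
  γ.lipschitzOnWith_arc.continuousOn

theorem lineIntegral_eq (ρ : X → ℝ≥0∞) :
    γ.lineIntegral ρ = ∫⁻ s in Icc 0 γ.length, ρ (γ.arc s) := rfl

theorem lineIntegral_mono {ρ ρ' : X → ℝ≥0∞} (h : ∀ x, ρ x ≤ ρ' x) :
    γ.lineIntegral ρ ≤ γ.lineIntegral ρ' :=
  lintegral_mono fun _ => h _

/-- The piece of `γ` between the arc length parameters `s` and `t`. -/
noncomputable def sub {s t : ℝ} (hs : 0 ≤ s) (hst : s ≤ t) (ht : t ≤ γ.length) :
    RectifiableCurve X where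
  toFun := γ.arc
  a := s
  b := t
  le := hst
  continuousOn := γ.continuousOn_arc.mono (Icc_subset_Icc hs ht)
  rectifiable := by
    rw [γ.eVariationOn_arc hs hst ht]
    exact ENNReal.ofReal_ne_top

theorem length_sub {s t : ℝ} (hs : 0 ≤ s) (hst : s ≤ t) (ht : t ≤ γ.length) :
    (γ.sub hs hst ht).length = t - s := by
  change (eVariationOn γ.arc (Icc s t)).toReal = t - s
  rw [γ.eVariationOn_arc hs hst ht, ENNReal.toReal_ofReal (sub_nonneg.2 hst)]

/-- `γ.arc` already has unit speed, so the arc length of the piece starting at `s` is the parameter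
shifted by `s`. -/
theorem arc_sub {s t : ℝ} (hs : 0 ≤ s) (hst : s ≤ t) (ht : t ≤ γ.length) {r : ℝ}
    (hr : r ∈ Icc 0 (t - s)) : (γ.sub hs hst ht).arc r = γ.arc (s + r) := by
  have hmem : s + r ∈ Icc s t := ⟨by linarith [hr.1], by linarith [hr.2]⟩
  have h := edist_naturalParameterization_eq_zero
    (γ.sub hs hst ht).boundedVariationOn.locallyBoundedVariationOn
    (left_mem_Icc.2 hst : s ∈ Icc s t) hmem
  have hv : variationOnFromTo γ.arc (Icc s t) s (s + r) = r := by
    rw [variationOnFromTo.eq_of_le _ _ hmem.1, inter_eq_right.2 (Icc_subset_Icc_right hmem.2),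
      γ.eVariationOn_arc hs hmem.1 (hmem.2.trans ht), add_sub_cancel_left,
      ENNReal.toReal_ofReal hr.1]
  change edist (naturalParameterization γ.arc (Icc s t) s
    (variationOnFromTo γ.arc (Icc s t) s (s + r))) (γ.arc (s + r)) = 0 at h
  rw [hv] at h
  exact edist_eq_zero.1 h

theorem lineIntegral_sub {s t : ℝ} (hs : 0 ≤ s) (hst : s ≤ t) (ht : t ≤ γ.length)
    (ρ : X → ℝ≥0∞) :
    (γ.sub hs hst ht).lineIntegral ρ = ∫⁻ r in Icc s t, ρ (γ.arc r) := by
  rw [lineIntegral_eq, γ.length_sub hs hst ht,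
    setLIntegral_congr_fun (g := fun r => ρ (γ.arc (s + r))) measurableSet_Icc
      (fun r hr => by rw [γ.arc_sub hs hst ht hr])]
  have h := (measurePreserving_add_left volume s).setLIntegral_comp_preimage_emb
    (measurableEmbedding_addLeft s) (fun r => ρ (γ.arc r)) (Icc s t)
  rw [← h, preimage_const_add_Icc, sub_self]

theorem lineIntegral_sub_le {s t : ℝ} (hs : 0 ≤ s) (hst : s ≤ t) (ht : t ≤ γ.length)
    (ρ : X → ℝ≥0∞) : (γ.sub hs hst ht).lineIntegral ρ ≤ γ.lineIntegral ρ := by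
  rw [γ.lineIntegral_sub, lineIntegral_eq]
  exact lintegral_mono_set (Icc_subset_Icc hs ht)

theorem aemeasurable_comp_arc [MeasurableSpace X] [BorelSpace X] {ρ : X → ℝ≥0∞}
    (hρ : Measurable ρ) :
    AEMeasurable (fun s => ρ (γ.arc s)) (volume.restrict (Icc 0 γ.length)) :=
  hρ.comp_aemeasurable (γ.continuousOn_arc.aemeasurable measurableSet_Icc)

end RectifiableCurve

end ArcLength

/-! ### Absolutely continuous functions on an interval -/

section RealLine

/-- The increments of `U` are dominated by those of the primitive `F` of `G`. Absolute continuity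
passes from `F` to `U`, and comparing difference quotients where `U` is differentiable and `F' = G`
bounds the derivative. -/
theorem absolutelyContinuousOnInterval_of_le_lintegral {U : ℝ → ℝ} {G : ℝ → ℝ≥0∞} {L : ℝ}
    (hL : 0 ≤ L) (hG : AEMeasurable G (volume.restrict (Icc 0 L)))
    (hfin : ∫⁻ s in Icc 0 L, G s ≠ ∞)
    (h : ∀ s t, 0 ≤ s → s ≤ t → t ≤ L → ENNReal.ofReal |U t - U s| ≤ ∫⁻ r in Icc s t, G r) :
    AbsolutelyContinuousOnInterval U 0 L ∧
      ∀ᵐ s ∂volume.restrict (Icc 0 L), ENNReal.ofReal |deriv U s| ≤ G s := by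
  have hint : IntegrableOn (fun s => (G s).toReal) (Icc 0 L) :=
    integrable_toReal_of_lintegral_ne_top hG hfin
  have hii : IntervalIntegrable (fun s => (G s).toReal) volume 0 L :=
    (intervalIntegrable_iff_integrableOn_Icc_of_le hL).2 hint
  set F : ℝ → ℝ := fun x => ∫ v in (0 : ℝ)..x, (G v).toReal with hF
  have hFAC : AbsolutelyContinuousOnInterval F 0 L :=
    hii.absolutelyContinuousOnInterval_intervalIntegral left_mem_uIcc
  have hsub : ∀ s t, 0 ≤ s → s ≤ t → t ≤ L → |U t - U s| ≤ F t - F s := by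
    intro s t hs hst ht
    have hst' : Icc s t ⊆ Icc 0 L := Icc_subset_Icc hs ht
    have h1 : F t - F s = ∫ v in s..t, (G v).toReal := by
      rw [hF]
      refine intervalIntegral.integral_interval_sub_left ?_ ?_
      · exact (intervalIntegrable_iff_integrableOn_Icc_of_le (hs.trans hst)).2
          (hint.mono_set (Icc_subset_Icc_right ht))
      · exact (intervalIntegrable_iff_integrableOn_Icc_of_le hs).2
          (hint.mono_set (Icc_subset_Icc_right (hst.trans ht)))
    have hfin' : ∫⁻ r in Icc s t, G r ≠ ∞ :=
      ne_top_of_le_ne_top hfin (lintegral_mono_set hst')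
    have hG' := hG.mono_measure (Measure.restrict_mono_set volume hst')
    rw [h1, intervalIntegral.integral_of_le hst, ← integral_Icc_eq_integral_Ioc,
      integral_toReal hG' (ae_lt_top' hG' hfin')]
    exact (ENNReal.ofReal_le_iff_le_toReal hfin').1 (h s t hs hst ht)
  have hdist : ∀ s ∈ Icc 0 L, ∀ t ∈ Icc 0 L, dist (U s) (U t) ≤ dist (F s) (F t) := by
    intro s hs t ht
    rcases le_total s t with hst | hst
    · rw [dist_comm, dist_comm (F s), Real.dist_eq, Real.dist_eq]
      exact (hsub s t hs.1 hst ht.2).trans (le_abs_self _)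
    · rw [Real.dist_eq, Real.dist_eq]
      exact (hsub t s ht.1 hst hs.2).trans (le_abs_self _)
  have hAC : AbsolutelyContinuousOnInterval U 0 L := by
    rw [absolutelyContinuousOnInterval_iff] at hFAC ⊢
    intro ε hε
    obtain ⟨δ, hδ, H⟩ := hFAC ε hε
    refine ⟨δ, hδ, fun E hE hlt => lt_of_le_of_lt (Finset.sum_le_sum fun i hi => ?_) (H E hE hlt)⟩
    have := hE.1 i hi
    rw [uIcc_of_le hL] at this
    exact hdist _ this.1 _ this.2
  refine ⟨hAC, ?_⟩
  rw [ae_restrict_iff' measurableSet_Icc]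
  -- Increments are controlled only inside `[0, L]`, so the two-sided slopes are compared at
  -- interior points.
  have h0 : ∀ᵐ x : ℝ, x ≠ 0 := by simp [ae_iff, measure_singleton]
  have h1 : ∀ᵐ x : ℝ, x ≠ L := by simp [ae_iff, measure_singleton]
  filter_upwards [hAC.ae_differentiableAt, hii.ae_hasDerivAt_integral, h0, h1]
    with x hx1 hx2 hx0 hxL hx
  have hx' : x ∈ uIcc 0 L := by rwa [uIcc_of_le hL]
  have hU := (hx1 hx').hasDerivAt
  have hFx := hx2 hx' 0 left_mem_uIcc
  rw [hasDerivAt_iff_tendsto_slope] at hU hFx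
  have hle : |deriv U x| ≤ |(G x).toReal| := by
    refine le_of_tendsto_of_tendsto hU.abs hFx.abs ?_
    have hmem : ∀ᶠ y in 𝓝[≠] x, y ∈ Icc 0 L :=
      mem_nhdsWithin_of_mem_nhds (Icc_mem_nhds (lt_of_le_of_ne hx.1 hx0.symm)
        (lt_of_le_of_ne hx.2 hxL))
    filter_upwards [hmem] with y hy
    have := hdist y hy x hx
    rw [Real.dist_eq, Real.dist_eq] at this
    simp only [slope, vsub_eq_sub, smul_eq_mul, abs_mul]
    exact mul_le_mul_of_nonneg_left this (abs_nonneg _)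
  rw [abs_of_nonneg ENNReal.toReal_nonneg] at hle
  exact (ENNReal.ofReal_le_ofReal hle).trans ENNReal.ofReal_toReal_le

theorem ofReal_abs_sub_le_lintegral {U : ℝ → ℝ} {G : ℝ → ℝ≥0∞} {L : ℝ} (hL : 0 ≤ L)
    (hU : AbsolutelyContinuousOnInterval U 0 L)
    (hd : ∀ᵐ s ∂volume.restrict (Icc 0 L), ENNReal.ofReal |deriv U s| ≤ G s) :
    ENNReal.ofReal |U L - U 0| ≤ ∫⁻ s in Icc 0 L, G s := by
  rw [← hU.integral_deriv_eq_sub, intervalIntegral.integral_of_le hL,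
    ← integral_Icc_eq_integral_Ioc, ← Real.norm_eq_abs, ofReal_norm]
  refine (enorm_integral_le_lintegral_enorm _).trans (lintegral_mono_ae ?_)
  filter_upwards [hd] with s hs
  rwa [← ofReal_norm, Real.norm_eq_abs]

end RealLine

/-! ### Modulus and properties of almost every curve -/

section Modulus

variable {X : Type*} [MetricSpace X] [MeasurableSpace X] {p : ℝ} {μ : Measure X}

theorem modulus_eq_zero_of_forall_exists {Γ : Set (RectifiableCurve X)}
    (h : ∀ ε : ℝ≥0∞, 0 < ε → ∃ ρ ∈ admissible Γ, ∫⁻ x, ρ x ^ p ∂μ ≤ ε) :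
    modulus p μ Γ = 0 := by
  refine le_antisymm (ENNReal.le_of_forall_pos_le_add fun ε hε _ => ?_) zero_le
  obtain ⟨ρ, hρ, hle⟩ := h ε (ENNReal.coe_pos.2 hε)
  rw [zero_add]
  exact (iInf₂_le ρ hρ).trans hle

theorem exists_admissible_of_modulus_eq_zero {Γ : Set (RectifiableCurve X)}
    (h : modulus p μ Γ = 0) {ε : ℝ≥0∞} (hε : 0 < ε) :
    ∃ ρ ∈ admissible Γ, ∫⁻ x, ρ x ^ p ∂μ ≤ ε := by
  rw [← h, modulus] at hε
  obtain ⟨ρ, hρ⟩ := iInf_lt_iff.1 hε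
  obtain ⟨hadm, hlt⟩ := iInf_lt_iff.1 hρ
  exact ⟨ρ, hadm, hlt.le⟩

theorem modulus_mono {Γ Γ' : Set (RectifiableCurve X)} (h : Γ ⊆ Γ') :
    modulus p μ Γ ≤ modulus p μ Γ' :=
  le_iInf₂ fun ρ hρ => iInf₂_le ρ ⟨hρ.1, fun γ hγ => hρ.2 γ (h hγ)⟩

/-- The supremum of functions admissible for the single families is admissible for the union, and
its `p`-th power is at most the sum of theirs. -/
theorem modulus_iUnion_eq_zero (hp : 0 < p) {ι : Type*} [Countable ι]
    {Γ : ι → Set (RectifiableCurve X)} (h : ∀ i, modulus p μ (Γ i) = 0) :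
    modulus p μ (⋃ i, Γ i) = 0 := by
  refine modulus_eq_zero_of_forall_exists fun ε hε => ?_
  obtain ⟨δ, hδ, hsum⟩ := ENNReal.exists_pos_sum_of_countable' hε.ne' ι
  choose ρ hρ hle using fun i => exists_admissible_of_modulus_eq_zero (h i) (hδ i)
  refine ⟨fun x => ⨆ i, ρ i x, ⟨Measurable.iSup fun i => (hρ i).1, fun γ hγ => ?_⟩, ?_⟩
  · obtain ⟨i, hi⟩ := mem_iUnion.1 hγ
    exact ((hρ i).2 γ hi).trans (γ.lineIntegral_mono fun x => le_iSup (fun i => ρ i x) i)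
  · calc ∫⁻ x, (⨆ i, ρ i x) ^ p ∂μ ≤ ∫⁻ x, ∑' i, ρ i x ^ p ∂μ := by
          refine lintegral_mono fun x => ?_
          rw [← ENNReal.le_rpow_inv_iff hp]
          refine iSup_le fun i => (ENNReal.le_rpow_inv_iff hp).2 ?_
          exact ENNReal.le_tsum (f := fun i => ρ i x ^ p) i
      _ = ∑' i, ∫⁻ x, ρ i x ^ p ∂μ :=
          lintegral_tsum fun i => ((hρ i).1.pow_const p).aemeasurable
      _ ≤ ∑' i, δ i := ENNReal.tsum_le_tsum hle
      _ ≤ ε := hsum.le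

/-- The filter of `p`-almost every curve. -/
def curveAE (hp : 0 < p) (μ : Measure X) : Filter (RectifiableCurve X) :=
  Filter.ofCountableUnion {Γ | modulus p μ Γ = 0}
    (fun S hS h => by
      have := hS.to_subtype
      rw [mem_ofPred_eq, sUnion_eq_iUnion]
      exact modulus_iUnion_eq_zero hp fun s => h s s.2)
    (fun _ ht _ hs => le_antisymm ((modulus_mono hs).trans_eq ht) zero_le)

instance (hp : 0 < p) (μ : Measure X) : CountableInterFilter (curveAE hp μ) := by
  unfold curveAE
  infer_instance

theorem eventually_curveAE {hp : 0 < p} {P : RectifiableCurve X → Prop} :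
    (∀ᶠ γ in curveAE hp μ, P γ) ↔ modulus p μ {γ | ¬ P γ} = 0 := Iff.rfl

theorem isWeakUpperGradient_iff (hp : 0 < p) {u : X → ℝ} {g : X → ℝ≥0∞} :
    IsWeakUpperGradient p μ u g ↔
      Measurable g ∧ ∀ᶠ γ in curveAE hp μ, UpperGradientIneq u g γ := Iff.rfl

/-- A function admissible for the exceptional curves is admissible for all curves containing one,
since line integrals grow with the curve. -/
theorem eventually_forall_sub {hp : 0 < p} {P : RectifiableCurve X → Prop}
    (h : ∀ᶠ γ in curveAE hp μ, P γ) :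
    ∀ᶠ γ in curveAE hp μ, ∀ (s t : ℝ) (hs : 0 ≤ s) (hst : s ≤ t) (ht : t ≤ γ.length),
      P (γ.sub hs hst ht) := by
  rw [eventually_curveAE] at h ⊢
  refine modulus_eq_zero_of_forall_exists fun ε hε => ?_
  obtain ⟨ρ, hρ, hle⟩ := exists_admissible_of_modulus_eq_zero h hε
  refine ⟨ρ, ⟨hρ.1, fun γ hγ => ?_⟩, hle⟩
  simp only [mem_ofPred_eq, not_forall] at hγ
  obtain ⟨s, t, hs, hst, ht, hP⟩ := hγ
  exact (hρ.2 _ hP).trans (γ.lineIntegral_sub_le hs hst ht ρ)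

/-- Every multiple `c * g` with `c > 0` is admissible for the curves of infinite integral; let `c`
tend to zero. -/
theorem eventually_lineIntegral_ne_top [BorelSpace X] {hp : 0 < p} {g : X → ℝ≥0∞}
    (hg : Measurable g) (hfin : ∫⁻ x, g x ^ p ∂μ < ∞) :
    ∀ᶠ γ in curveAE hp μ, γ.lineIntegral g ≠ ∞ := by
  rw [eventually_curveAE]
  refine le_antisymm ?_ zero_le
  have hadm (c : ℝ≥0) (hc : 0 < c) :
      modulus p μ {γ | ¬ γ.lineIntegral g ≠ ∞} ≤ (c : ℝ≥0∞) ^ p * ∫⁻ x, g x ^ p ∂μ := by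
    have hmem : (fun x => c * g x) ∈ admissible {γ | ¬ γ.lineIntegral g ≠ ∞} := by
      refine ⟨hg.const_mul _, fun γ hγ => ?_⟩
      simp only [mem_ofPred_eq, not_not] at hγ
      have : γ.lineIntegral (fun x => c * g x) = c * γ.lineIntegral g :=
        lintegral_const_mul'' _ (γ.aemeasurable_comp_arc hg)
      rw [this, hγ, ENNReal.mul_top (ENNReal.coe_ne_zero.2 hc.ne')]
      exact le_top
    refine (iInf₂_le _ hmem).trans_eq ?_
    simp_rw [ENNReal.mul_rpow_of_nonneg _ _ hp.le]
    exact lintegral_const_mul _ (hg.pow_const p)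
  have hlim : Tendsto (fun c : ℝ≥0 => (c : ℝ≥0∞) ^ p * ∫⁻ x, g x ^ p ∂μ) (𝓝[>] 0) (𝓝 0) := by
    have h1 : Tendsto (fun c : ℝ≥0 => (c : ℝ≥0∞) ^ p) (𝓝[>] 0) (𝓝 0) := by
      have := (ENNReal.continuous_rpow_const (y := p)).comp ENNReal.continuous_coe
      simpa [Function.comp_def, ENNReal.zero_rpow_of_pos hp] using (this.tendsto 0).mono_left nhdsWithin_le_nhds
    simpa using ENNReal.Tendsto.mul_const h1 (Or.inr hfin.ne)
  refine ge_of_tendsto hlim ?_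
  filter_upwards [self_mem_nhdsWithin] with c hc using hadm c hc

end Modulus

/-! ### Calculus along curves -/

section Derivative

variable {X : Type*} [MetricSpace X]

/-- `u` is absolutely continuous along `γ`, with derivative bounded by `g`. -/
def RectifiableCurve.DerivLE (γ : RectifiableCurve X) (u : X → ℝ) (g : X → ℝ≥0∞) : Prop :=
  AbsolutelyContinuousOnInterval (fun s => u (γ.arc s)) 0 γ.length ∧
    ∀ᵐ s ∂volume.restrict (Icc 0 γ.length),
      ENNReal.ofReal |deriv (fun s => u (γ.arc s)) s| ≤ g (γ.arc s)

namespace RectifiableCurve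

variable {γ : RectifiableCurve X} {u v : X → ℝ} {g g' : X → ℝ≥0∞}

theorem ae_mem_Ioo (γ : RectifiableCurve X) :
    ∀ᵐ s ∂volume.restrict (Icc 0 γ.length), s ∈ Ioo 0 γ.length := by
  rw [restrict_Ioo_eq_restrict_Icc.symm]
  exact ae_restrict_mem measurableSet_Ioo

theorem DerivLE.ae_differentiableAt (h : γ.DerivLE u g) :
    ∀ᵐ s ∂volume.restrict (Icc 0 γ.length), DifferentiableAt ℝ (fun s => u (γ.arc s)) s := by
  have := h.1.ae_differentiableAt
  rwa [uIcc_of_le γ.length_nonneg, ← ae_restrict_iff' measurableSet_Icc] at this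

theorem DerivLE.upperGradientIneq [MeasurableSpace X] (h : γ.DerivLE u g) :
    UpperGradientIneq u g γ := by
  have := ofReal_abs_sub_le_lintegral γ.length_nonneg h.1 h.2
  rwa [γ.arc_zero, γ.arc_length] at this

/-- The upper gradient inequality on one curve does not pass to a minimum; the pointwise derivative
bound does. -/
theorem DerivLE.inf (h : γ.DerivLE u g) (h' : γ.DerivLE u g') :
    γ.DerivLE u (fun x => min (g x) (g' x)) := by
  refine ⟨h.1, ?_⟩
  filter_upwards [h.2, h'.2] with s hs hs' using le_min hs hs'

theorem DerivLE.add (h : γ.DerivLE u g) (h' : γ.DerivLE v g') :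
    γ.DerivLE (fun x => u x + v x) (fun x => g x + g' x) := by
  refine ⟨h.1.fun_add h'.1, ?_⟩
  filter_upwards [h.2, h'.2, h.ae_differentiableAt, h'.ae_differentiableAt] with s hs hs' hd hd'
  rw [deriv_fun_add hd hd']
  exact (ENNReal.ofReal_le_ofReal (abs_add_le _ _)).trans
    (ENNReal.ofReal_add_le.trans (add_le_add hs hs'))

theorem DerivLE.mul (h : γ.DerivLE u g) (h' : γ.DerivLE v g') :
    γ.DerivLE (fun x => u x * v x)
      (fun x => ENNReal.ofReal |v x| * g x + ENNReal.ofReal |u x| * g' x) := by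
  refine ⟨h.1.fun_mul h'.1, ?_⟩
  filter_upwards [h.2, h'.2, h.ae_differentiableAt, h'.ae_differentiableAt] with s hs hs' hd hd'
  rw [deriv_fun_mul hd hd']
  refine (ENNReal.ofReal_le_ofReal (abs_add_le _ _)).trans
    (ENNReal.ofReal_add_le.trans (add_le_add ?_ ?_))
  · rw [abs_mul, ENNReal.ofReal_mul (abs_nonneg _), mul_comm]
    exact mul_le_mul_right hs _
  · rw [abs_mul, ENNReal.ofReal_mul (abs_nonneg _)]
    exact mul_le_mul_right hs' _

/-- Off the closed support `u` vanishes locally, so its derivative is zero there; elsewhere the unit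
speed parametrization keeps the Lipschitz constant. -/
theorem derivLE_of_lipschitzWith (γ : RectifiableCurve X) {K : ℝ≥0} (hu : LipschitzWith K u) :
    γ.DerivLE u ((tsupport u).indicator fun _ => (K : ℝ≥0∞)) := by
  have hlip : LipschitzOnWith K (fun s => u (γ.arc s)) (Icc 0 γ.length) := by
    simpa [Function.comp_def] using hu.comp_lipschitzOnWith γ.lipschitzOnWith_arc
  refine ⟨LipschitzOnWith.absolutelyContinuousOnInterval
    (by rwa [uIcc_of_le γ.length_nonneg]), ?_⟩
  filter_upwards [γ.ae_mem_Ioo] with s hs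
  have hnhds : Icc 0 γ.length ∈ 𝓝 s := Icc_mem_nhds hs.1 hs.2
  by_cases hmem : γ.arc s ∈ tsupport u
  · rw [indicator_of_mem hmem, ← ENNReal.ofReal_coe_nnreal]
    exact ENNReal.ofReal_le_ofReal (norm_deriv_le_of_lipschitzOn hnhds hlip)
  · have hcont : ContinuousAt γ.arc s := γ.continuousOn_arc.continuousAt hnhds
    have hev : (fun s => u (γ.arc s)) =ᶠ[𝓝 s] fun _ => 0 := by
      filter_upwards [hcont.eventually_mem ((isClosed_tsupport u).isOpen_compl.mem_nhds hmem)]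
        with t ht
      exact image_eq_zero_of_notMem_tsupport ht
    rw [hev.deriv_eq, deriv_const, abs_zero, ENNReal.ofReal_zero]
    exact zero_le

end RectifiableCurve

variable [MeasurableSpace X] {p : ℝ} {μ : Measure X} {u v : X → ℝ} {g g' : X → ℝ≥0∞}

theorem isWeakUpperGradient_of_derivLE (hp : 0 < p) (hg : Measurable g)
    (h : ∀ᶠ γ in curveAE hp μ, γ.DerivLE u g) : IsWeakUpperGradient p μ u g :=
  (isWeakUpperGradient_iff hp).2 ⟨hg, h.mono fun _ hγ => hγ.upperGradientIneq⟩

theorem IsWeakUpperGradient.eventually_derivLE [BorelSpace X] (hp : 0 < p)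
    (hg : IsWeakUpperGradient p μ u g) (hfin : ∫⁻ x, g x ^ p ∂μ < ∞) :
    ∀ᶠ γ in curveAE hp μ, γ.DerivLE u g := by
  filter_upwards [eventually_forall_sub ((isWeakUpperGradient_iff hp).1 hg).2,
    eventually_lineIntegral_ne_top hg.1 hfin] with γ hγ hγfin
  refine absolutelyContinuousOnInterval_of_le_lintegral γ.length_nonneg
    (γ.aemeasurable_comp_arc hg.1) hγfin fun s t hs hst ht => ?_
  rw [← γ.lineIntegral_sub hs hst ht]
  exact hγ s t hs hst ht

end Derivative

/-! ### Estimates for `p`-th power integrals -/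

section Lintegral

variable {X : Type*} [MeasurableSpace X] {p : ℝ} {μ : Measure X} {u : X → ℝ} {g g' : X → ℝ≥0∞}

theorem lintegral_add_rpow_le (hp : 1 ≤ p) (hg : Measurable g) :
    ∫⁻ x, (g x + g' x) ^ p ∂μ ≤
      2 ^ (p - 1) * (∫⁻ x, g x ^ p ∂μ + ∫⁻ x, g' x ^ p ∂μ) := by
  rw [← lintegral_add_left (hg.pow_const p), ← lintegral_const_mul' _ _
    (ENNReal.rpow_ne_top_of_nonneg (sub_nonneg.2 hp) ENNReal.ofNat_ne_top)]
  exact lintegral_mono fun x => ENNReal.rpow_add_le_mul_rpow_add_rpow _ _ hp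

theorem lintegral_mul_rpow_le (hp : 0 ≤ p) {M : ℝ} (hM : ∀ x, |u x| ≤ M) :
    ∫⁻ x, (ENNReal.ofReal |u x| * g x) ^ p ∂μ ≤
      ENNReal.ofReal M ^ p * ∫⁻ x, g x ^ p ∂μ := by
  rw [← lintegral_const_mul' _ _ (ENNReal.rpow_ne_top_of_nonneg hp ENNReal.ofReal_ne_top)]
  refine lintegral_mono fun x => ?_
  rw [← ENNReal.mul_rpow_of_nonneg _ _ hp]
  exact ENNReal.rpow_le_rpow (mul_le_mul_left (ENNReal.ofReal_le_ofReal (hM x)) _) hp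

theorem measurable_ofReal_abs_mul (hu : Measurable u) (hg : Measurable g) :
    Measurable fun x => ENNReal.ofReal |u x| * g x :=
  ((measurable_abs.comp hu).ennreal_ofReal).mul hg

theorem tendsto_lintegral_mul_rpow_zero (hp : 0 < p) {w : ℕ → X → ℝ} {g : X → ℝ≥0∞}
    (hw : ∀ n, Measurable (w n)) {M : ℝ} (hM : ∀ n x, |w n x| ≤ M)
    (hlim : ∀ x, Tendsto (fun n => w n x) atTop (𝓝 0)) (hg : Measurable g)
    (hfin : ∫⁻ x, g x ^ p ∂μ < ∞) :
    Tendsto (fun n => ∫⁻ x, (ENNReal.ofReal |w n x| * g x) ^ p ∂μ) atTop (𝓝 0) := by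
  have h := tendsto_lintegral_of_dominated_convergence (μ := μ)
    (F := fun n x => (ENNReal.ofReal |w n x| * g x) ^ p) (f := fun _ => 0)
    (fun x => (ENNReal.ofReal M * g x) ^ p)
    (fun n => (measurable_ofReal_abs_mul (hw n) hg).pow_const p)
    (fun n => .of_forall fun x => ENNReal.rpow_le_rpow
      (mul_le_mul_left (ENNReal.ofReal_le_ofReal (hM n x)) _) hp.le) ?_ ?_
  · simpa using h
  · simp_rw [ENNReal.mul_rpow_of_nonneg _ _ hp.le]
    rw [lintegral_const_mul _ (hg.pow_const p)]
    exact (ENNReal.mul_lt_top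
      (ENNReal.rpow_lt_top_of_nonneg hp.le ENNReal.ofReal_ne_top) hfin).ne
  -- Pointwise convergence needs `g x` finite, which holds almost everywhere by integrability.
  · filter_upwards [ae_lt_top (hg.pow_const p) hfin.ne] with x hx
    have hgx : g x ≠ ∞ := ((ENNReal.rpow_lt_top_iff_of_pos hp).1 hx).ne
    have h1 : Tendsto (fun n => ENNReal.ofReal |w n x|) atTop (𝓝 0) := by
      simpa using ENNReal.tendsto_ofReal (hlim x).abs
    have h2 := ENNReal.Tendsto.mul_const (b := g x) h1 (Or.inr hgx)
    have h3 := (ENNReal.continuous_rpow_const (y := p)).tendsto (0 * g x) |>.comp h2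
    simpa [Function.comp_def, ENNReal.zero_rpow_of_pos hp] using h3

end Lintegral

/-! ### Integrable gradients and minimal gradients -/

section LpGradient

variable {X : Type*} [MetricSpace X] [MeasurableSpace X] {p : ℝ} {μ : Measure X}
  {u v : X → ℝ} {g g' : X → ℝ≥0∞}

/-- `g` is a `p`-integrable `p`-weak upper gradient of `u`. -/
def IsLpGradient (p : ℝ) (μ : Measure X) (u : X → ℝ) (g : X → ℝ≥0∞) : Prop :=
  IsWeakUpperGradient p μ u g ∧ ∫⁻ x, g x ^ p ∂μ < ∞

theorem IsMinimalWeakUpperGradient.isLpGradient (h : IsMinimalWeakUpperGradient p μ u g) :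
    IsLpGradient p μ u g :=
  ⟨h.1, h.2.1⟩

theorem isLpGradient_const (hp : 0 < p) (c : ℝ) : IsLpGradient p μ (fun _ => c) fun _ => 0 := by
  refine ⟨(isWeakUpperGradient_iff hp).2 ⟨measurable_const, .of_forall fun γ => ?_⟩, ?_⟩
  · simp [UpperGradientIneq]
  · simp [ENNReal.zero_rpow_of_pos hp]

theorem IsLpGradient.of_abs_sub_le [BorelSpace X] (hp : 0 < p) (hu : IsLpGradient p μ u g)
    {K : ℝ≥0} (h : ∀ x y, |v x - v y| ≤ K * |u x - u y|) :
    IsLpGradient p μ v fun x => K * g x := by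
  refine ⟨(isWeakUpperGradient_iff hp).2 ⟨hu.1.1.const_mul _, ?_⟩, ?_⟩
  · filter_upwards [((isWeakUpperGradient_iff hp).1 hu.1).2] with γ hγ
    have heq : γ.lineIntegral (fun x => K * g x) = K * γ.lineIntegral g :=
      lintegral_const_mul'' _ (γ.aemeasurable_comp_arc hu.1.1)
    rw [UpperGradientIneq, heq]
    refine (ENNReal.ofReal_le_ofReal (h _ _)).trans ?_
    rw [ENNReal.ofReal_mul K.coe_nonneg, ENNReal.ofReal_coe_nnreal]
    exact mul_le_mul_right hγ _
  · simp_rw [ENNReal.mul_rpow_of_nonneg _ _ hp.le]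
    rw [lintegral_const_mul _ (hu.1.1.pow_const p)]
    exact ENNReal.mul_lt_top
      (ENNReal.rpow_lt_top_of_nonneg hp.le ENNReal.coe_ne_top) hu.2

theorem IsLpGradient.inf [BorelSpace X] (hp : 0 < p) (hg : IsLpGradient p μ u g)
    (hg' : IsLpGradient p μ u g') : IsLpGradient p μ u fun x => min (g x) (g' x) := by
  refine ⟨isWeakUpperGradient_of_derivLE hp (hg.1.1.min hg'.1.1) ?_, ?_⟩
  · filter_upwards [hg.1.eventually_derivLE hp hg.2, hg'.1.eventually_derivLE hp hg'.2]
      with γ h h' using h.inf h'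
  · exact (lintegral_mono fun x => ENNReal.rpow_le_rpow (min_le_left _ _) hp.le).trans_lt hg.2

theorem IsLpGradient.add [BorelSpace X] (hp : 1 ≤ p) (hu : IsLpGradient p μ u g)
    (hv : IsLpGradient p μ v g') :
    IsLpGradient p μ (fun x => u x + v x) fun x => g x + g' x := by
  have hp0 : 0 < p := one_pos.trans_le hp
  refine ⟨isWeakUpperGradient_of_derivLE hp0 (hu.1.1.add hv.1.1) ?_, ?_⟩
  · filter_upwards [hu.1.eventually_derivLE hp0 hu.2, hv.1.eventually_derivLE hp0 hv.2]
      with γ h h' using h.add h'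
  · exact (lintegral_add_rpow_le hp hu.1.1).trans_lt (ENNReal.mul_lt_top
      (ENNReal.rpow_lt_top_of_nonneg (sub_nonneg.2 hp) ENNReal.ofNat_ne_top)
      (ENNReal.add_lt_top.2 ⟨hu.2, hv.2⟩))

theorem IsLpGradient.mul [BorelSpace X] (hp : 1 ≤ p) (hu : IsLpGradient p μ u g)
    (hv : IsLpGradient p μ v g') (hum : Measurable u) (hvm : Measurable v) {M N : ℝ}
    (hM : ∀ x, |u x| ≤ M) (hN : ∀ x, |v x| ≤ N) :
    IsLpGradient p μ (fun x => u x * v x)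
      fun x => ENNReal.ofReal |v x| * g x + ENNReal.ofReal |u x| * g' x := by
  have hp0 : 0 < p := one_pos.trans_le hp
  have hm := measurable_ofReal_abs_mul hvm hu.1.1
  refine ⟨isWeakUpperGradient_of_derivLE hp0 (hm.add (measurable_ofReal_abs_mul hum hv.1.1)) ?_,
    ?_⟩
  · filter_upwards [hu.1.eventually_derivLE hp0 hu.2, hv.1.eventually_derivLE hp0 hv.2]
      with γ h h' using h.mul h'
  · have hfin (M : ℝ) : ENNReal.ofReal M ^ p < ∞ :=
      ENNReal.rpow_lt_top_of_nonneg hp0.le ENNReal.ofReal_ne_top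
    refine (lintegral_add_rpow_le hp hm).trans_lt (ENNReal.mul_lt_top
      (ENNReal.rpow_lt_top_of_nonneg (sub_nonneg.2 hp) ENNReal.ofNat_ne_top)
      (ENNReal.add_lt_top.2 ⟨?_, ?_⟩))
    · exact (lintegral_mul_rpow_le hp0.le hN).trans_lt (ENNReal.mul_lt_top (hfin N) hu.2)
    · exact (lintegral_mul_rpow_le hp0.le hM).trans_lt (ENNReal.mul_lt_top (hfin M) hv.2)

/-- Monotone convergence for decreasing sequences needs a finite first integral, available on almost
every curve. -/
theorem IsLpGradient.iInf [BorelSpace X] (hp : 0 < p) {h : ℕ → X → ℝ≥0∞}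
    (hh : ∀ n, IsLpGradient p μ u (h n)) (hanti : ∀ x, Antitone fun n => h n x) :
    IsLpGradient p μ u fun x => ⨅ n, h n x := by
  refine ⟨(isWeakUpperGradient_iff hp).2 ⟨Measurable.iInf fun n => (hh n).1.1, ?_⟩, ?_⟩
  · filter_upwards [eventually_countable_forall.2 fun n =>
        ((isWeakUpperGradient_iff hp).1 (hh n).1).2,
      eventually_lineIntegral_ne_top (hh 0).1.1 (hh 0).2] with γ hγ hfin
    have : γ.lineIntegral (fun x => ⨅ n, h n x) = ⨅ n, γ.lineIntegral (h n) :=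
      lintegral_iInf' (fun n => γ.aemeasurable_comp_arc (hh n).1.1)
        (.of_forall fun s => hanti (γ.arc s)) hfin
    rw [UpperGradientIneq, this]
    exact le_iInf hγ
  · exact (lintegral_mono fun x =>
      ENNReal.rpow_le_rpow (iInf_le (fun n => h n x) 0) hp.le).trans_lt (hh 0).2

/-- Gradients are closed under minima and decreasing limits, so running minima of a minimizing
sequence converge to a gradient `H` of least energy. For any other gradient `g₁`, `min H g₁` has no
less energy than `H`, hence equals `H` almost everywhere. -/
theorem IsLpGradient.exists_isMinimalWeakUpperGradient [BorelSpace X] (hp : 0 < p)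
    (hu : IsLpGradient p μ u g) : ∃ h, IsMinimalWeakUpperGradient p μ u h := by
  set S : Set ℝ≥0∞ := (fun g : X → ℝ≥0∞ => ∫⁻ x, g x ^ p ∂μ) '' {g | IsLpGradient p μ u g}
  obtain ⟨I, -, hlim, hI⟩ := exists_seq_tendsto_sInf (S := S) ⟨_, g, hu, rfl⟩ (OrderBot.bddBelow S)
  choose f hf hfI using hI
  set h : ℕ → X → ℝ≥0∞ := fun n x => Nat.rec (f 0 x) (fun k r => min r (f (k + 1) x)) n
  have hsucc (n : ℕ) : h (n + 1) = fun x => min (h n x) (f (n + 1) x) := rfl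
  have hh (n : ℕ) : IsLpGradient p μ u (h n) := by
    induction n with
    | zero => exact hf 0
    | succ n ih =>
      rw [hsucc]
      exact ih.inf hp (hf (n + 1))
  have hle (n : ℕ) (x : X) : h n x ≤ f n x := by
    cases n with
    | zero => exact le_rfl
    | succ n => exact min_le_right _ _
  have hanti (x : X) : Antitone fun n => h n x :=
    antitone_nat_of_succ_le fun n => min_le_left _ _
  have hH := IsLpGradient.iInf hp hh hanti
  set H : X → ℝ≥0∞ := fun x => ⨅ n, h n x
  have hHI : ∫⁻ x, H x ^ p ∂μ ≤ sInf S := by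
    refine ge_of_tendsto' hlim fun n => ?_
    rw [← hfI n]
    exact lintegral_mono fun x =>
      ENNReal.rpow_le_rpow ((iInf_le (fun n => h n x) n).trans (hle n x)) hp.le
  refine ⟨H, hH.1, hH.2, fun g₁ hg₁ hfin₁ => ?_⟩
  have hmin := hH.inf hp ⟨hg₁, hfin₁⟩
  have hae := ae_eq_of_ae_le_of_lintegral_le (μ := μ) (f := fun x => min (H x) (g₁ x) ^ p)
    (g := fun x => H x ^ p)
    (.of_forall fun x => ENNReal.rpow_le_rpow (min_le_left _ _) hp.le) hmin.2.ne
    (hH.1.1.pow_const p).aemeasurable (hHI.trans (sInf_le ⟨_, hmin, rfl⟩))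
  filter_upwards [hae] with x hx
  rw [← ENNReal.rpow_left_injective hp.ne' hx]
  exact min_le_right _ _

theorem mem_BD_iff [BorelSpace X] (hp : 0 < p) :
    u ∈ BD p μ ↔ Continuous u ∧ (∃ M : ℝ, ∀ x, |u x| ≤ M) ∧ ∃ g, IsLpGradient p μ u g :=
  and_congr_right fun _ => and_congr_right fun _ =>
    ⟨fun ⟨g, hg⟩ => ⟨g, hg.isLpGradient⟩, fun ⟨_, hg⟩ => hg.exists_isMinimalWeakUpperGradient hp⟩

theorem bdConverges_of_isLpGradient [BorelSpace X] (hp : 0 < p) {v : ℕ → X → ℝ}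
    {g : ℕ → X → ℝ≥0∞} (hb : ∃ M : ℝ, ∀ n x, |v n x| ≤ M)
    (hv : ∀ K : Set X, IsCompact K → TendstoUniformlyOn v u atTop K)
    (hg : ∀ n, IsLpGradient p μ (fun x => v n x - u x) (g n))
    (hlim : Tendsto (fun n => ∫⁻ x, g n x ^ p ∂μ) atTop (𝓝 0)) : BDConverges p μ v u := by
  choose h hh using fun n => (hg n).exists_isMinimalWeakUpperGradient hp
  refine ⟨hb, hv, h, hh, tendsto_of_tendsto_of_tendsto_of_le_of_le tendsto_const_nhds hlim
    (fun _ => zero_le) fun n => lintegral_mono_ae ?_⟩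
  filter_upwards [(hh n).2.2 _ (hg n).1 (hg n).2] with x hx
  exact ENNReal.rpow_le_rpow hx hp.le

end LpGradient

/-! ### The algebra `BD` and the ideal property of the closure -/

section Algebra

variable {X : Type*} [MetricSpace X] [MeasurableSpace X] [BorelSpace X] {p : ℝ} {μ : Measure X}
  {u v : X → ℝ}

theorem const_mem_BD (hp : 0 < p) (c : ℝ) : (fun _ => c) ∈ BD p μ :=
  (mem_BD_iff hp).2 ⟨continuous_const, ⟨|c|, fun _ => le_rfl⟩, _, isLpGradient_const hp c⟩

theorem BD.add (hp : 1 ≤ p) (hu : u ∈ BD p μ) (hv : v ∈ BD p μ) :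
    (fun x => u x + v x) ∈ BD p μ := by
  have hp0 : 0 < p := one_pos.trans_le hp
  rw [mem_BD_iff hp0] at hu hv ⊢
  obtain ⟨hu, ⟨M, hM⟩, g, hg⟩ := hu
  obtain ⟨hv, ⟨N, hN⟩, g', hg'⟩ := hv
  exact ⟨hu.add hv, ⟨M + N, fun x => (abs_add_le _ _).trans (add_le_add (hM x) (hN x))⟩, _,
    hg.add hp hg'⟩

theorem abs_mul_le_mul_of_le {a b M N : ℝ} (ha : |a| ≤ M) (hb : |b| ≤ N) : |a * b| ≤ M * N := by
  rw [abs_mul]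
  exact mul_le_mul ha hb (abs_nonneg _) ((abs_nonneg _).trans ha)

theorem BD.mul (hp : 1 ≤ p) (hu : u ∈ BD p μ) (hv : v ∈ BD p μ) :
    (fun x => u x * v x) ∈ BD p μ := by
  have hp0 : 0 < p := one_pos.trans_le hp
  rw [mem_BD_iff hp0] at hu hv ⊢
  obtain ⟨hu, ⟨M, hM⟩, g, hg⟩ := hu
  obtain ⟨hv, ⟨N, hN⟩, g', hg'⟩ := hv
  exact ⟨hu.mul hv, ⟨M * N, fun x => abs_mul_le_mul_of_le (hM x) (hN x)⟩, _,
    hg.mul hp hg' hu.measurable hv.measurable hM hN⟩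

/-- On `[c, ∞)` the map $t\mapsto 1/t$ is Lipschitz with constant $c^{-2}$. -/
theorem BD.inv (hp : 0 < p) (hu : u ∈ BD p μ) {c : ℝ} (hc : 0 < c) (h : ∀ x, c ≤ u x) :
    (fun x => (u x)⁻¹) ∈ BD p μ := by
  rw [mem_BD_iff hp] at hu ⊢
  obtain ⟨hu, -, g, hg⟩ := hu
  have hpos (x : X) : 0 < u x := hc.trans_le (h x)
  refine ⟨hu.inv₀ fun x => (hpos x).ne', ⟨c⁻¹, fun x => ?_⟩, _,
    hg.of_abs_sub_le hp (K := (c⁻¹ * c⁻¹).toNNReal) fun x y => ?_⟩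
  · rw [abs_of_pos (inv_pos.2 (hpos x))]
    exact inv_anti₀ hc (h x)
  · rw [Real.coe_toNNReal _ (by positivity), inv_sub_inv (hpos x).ne' (hpos y).ne', abs_div,
      abs_sub_comm, div_eq_inv_mul, abs_of_pos (mul_pos (hpos x) (hpos y)), mul_inv]
    exact mul_le_mul_of_nonneg_right (mul_le_mul (inv_anti₀ hc (h x)) (inv_anti₀ hc (h y))
      (inv_pos.2 (hpos y)).le (inv_pos.2 hc).le) (abs_nonneg _)

theorem BDc.subset_BDcClosure (hp : 0 < p) (hu : u ∈ BDc p μ) : u ∈ BDcClosure p μ := by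
  refine ⟨fun _ => u, fun _ => hu, bdConverges_of_isLpGradient hp (g := fun _ _ => 0) ?_ ?_ ?_ ?_⟩
  · obtain ⟨M, hM⟩ := hu.1.2.1
    exact ⟨M, fun _ => hM⟩
  · exact fun K _ s hs => .of_forall fun _ x _ => refl_mem_uniformity hs
  · intro n
    simpa using isLpGradient_const hp 0
  · simp [ENNReal.zero_rpow_of_pos hp]

theorem BDcClosure.add (hp : 1 ≤ p) (hu : u ∈ BDcClosure p μ) (hv : v ∈ BDcClosure p μ) :
    (fun x => u x + v x) ∈ BDcClosure p μ := by
  have hp0 : 0 < p := one_pos.trans_le hp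
  obtain ⟨a, ha, ⟨M, hM⟩, hau, g, hg, hglim⟩ := hu
  obtain ⟨b, hb, ⟨N, hN⟩, hbv, g', hg', hglim'⟩ := hv
  refine ⟨fun n x => a n x + b n x,
    fun n => ⟨BD.add hp (ha n).1 (hb n).1, (ha n).2.add (hb n).2⟩,
    bdConverges_of_isLpGradient hp0 (g := fun n x => g n x + g' n x)
      ⟨M + N, fun n x => (abs_add_le _ _).trans (add_le_add (hM n x) (hN n x))⟩
      (fun K hK => (hau K hK).add (hbv K hK)) (fun n => ?_) ?_⟩
  · have := (hg n).isLpGradient.add hp (hg' n).isLpGradient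
    simpa only [add_sub_add_comm] using this
  · have hlim := ENNReal.Tendsto.const_mul (a := 2 ^ (p - 1)) (hglim.add hglim')
      (Or.inr (ENNReal.rpow_ne_top_of_nonneg (sub_nonneg.2 hp) ENNReal.ofNat_ne_top))
    rw [add_zero, mul_zero] at hlim
    exact tendsto_of_tendsto_of_tendsto_of_le_of_le tendsto_const_nhds hlim
      (fun _ => zero_le) fun n => lintegral_add_rpow_le hp (hg n).1.1

/-- The products `a n * v` have compact support, and $(a_n-u)v$ has gradient $|v|g_n+|a_n-u|g'$. The
first term tends to zero in $L^p$ because `v` is bounded, the second by dominated convergence. -/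
theorem BDcClosure.mul (hp : 1 ≤ p) (hu : u ∈ BDcClosure p μ) (huB : u ∈ BD p μ)
    (hv : v ∈ BD p μ) : (fun x => u x * v x) ∈ BDcClosure p μ := by
  have hp0 : 0 < p := one_pos.trans_le hp
  obtain ⟨a, ha, ⟨M, hM⟩, hau, g, hg, hglim⟩ := hu
  obtain ⟨hvc, ⟨N, hN⟩, g', hg'⟩ := id hv
  obtain ⟨huc, ⟨R, hR⟩, -⟩ := huB
  have hm (n : ℕ) : Measurable fun x => a n x - u x :=
    (ha n).1.1.measurable.sub huc.measurable
  have hMR (n : ℕ) (x : X) : |a n x - u x| ≤ M + R :=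
    (abs_sub _ _).trans (add_le_add (hM n x) (hR x))
  refine ⟨fun n x => a n x * v x, fun n => ⟨BD.mul hp (ha n).1 hv, (ha n).2.mul_right⟩,
    bdConverges_of_isLpGradient hp0
      (g := fun n x => ENNReal.ofReal |v x| * g n x + ENNReal.ofReal |a n x - u x| * g' x)
      ⟨M * N, fun n x => abs_mul_le_mul_of_le (hM n x) (hN x)⟩ (fun K hK => ?_) (fun n => ?_) ?_⟩
  -- The bound `N` may be zero, so the divisor is enlarged to a positive one.
  · have hN1 : 0 < |N| + 1 := by positivity
    rw [Metric.tendstoUniformlyOn_iff]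
    intro ε hε
    filter_upwards [Metric.tendstoUniformlyOn_iff.1 (hau K hK) (ε / (|N| + 1)) (by positivity)]
      with n hn x hx
    have h1 := hn x hx
    rw [Real.dist_eq] at h1 ⊢
    rw [← sub_mul, abs_mul]
    calc |u x - a n x| * |v x| ≤ |u x - a n x| * (|N| + 1) := by
          gcongr
          linarith [hN x, le_abs_self N]
      _ < ε / (|N| + 1) * (|N| + 1) := by gcongr
      _ = ε := div_mul_cancel₀ _ hN1.ne'
  · have := (hg n).isLpGradient.mul hp hg'.isLpGradient (hm n) hvc.measurable (hMR n) hN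
    simpa only [sub_mul] using this
  · have h1 : Tendsto (fun n => ∫⁻ x, (ENNReal.ofReal |v x| * g n x) ^ p ∂μ) atTop (𝓝 0) := by
      have := ENNReal.Tendsto.const_mul (a := ENNReal.ofReal N ^ p) hglim
        (Or.inr (ENNReal.rpow_ne_top_of_nonneg hp0.le ENNReal.ofReal_ne_top))
      rw [mul_zero] at this
      exact tendsto_of_tendsto_of_tendsto_of_le_of_le tendsto_const_nhds this
        (fun _ => zero_le) fun n => lintegral_mul_rpow_le hp0.le hN
    have h2 := tendsto_lintegral_mul_rpow_zero (μ := μ) hp0 hm hMR (fun x => by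
      have := (hau {x} isCompact_singleton).tendsto_at (mem_singleton x)
      simpa using this.sub_const (u x)) hg'.1.1 hg'.2.1
    have hlim := ENNReal.Tendsto.const_mul (a := 2 ^ (p - 1)) (h1.add h2)
      (Or.inr (ENNReal.rpow_ne_top_of_nonneg (sub_nonneg.2 hp) ENNReal.ofNat_ne_top))
    rw [add_zero, mul_zero] at hlim
    exact tendsto_of_tendsto_of_tendsto_of_le_of_le tendsto_const_nhds hlim
      (fun _ => zero_le) fun n =>
        lintegral_add_rpow_le hp (measurable_ofReal_abs_mul hvc.measurable (hg n).1.1)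

theorem zero_mem_BDcClosure (hp : 0 < p) : (fun _ => (0 : ℝ)) ∈ BDcClosure p μ :=
  BDc.subset_BDcClosure hp ⟨const_mem_BD hp 0, HasCompactSupport.zero⟩

theorem sum_mul_self_mem {ι : Type*} (hp : 1 ≤ p) (s : Finset ι) {f : ι → X → ℝ}
    (hf : ∀ i ∈ s, f i ∈ BD p μ ∧ f i ∈ BDcClosure p μ) :
    (fun x => ∑ i ∈ s, f i x * f i x) ∈ BD p μ ∧
      (fun x => ∑ i ∈ s, f i x * f i x) ∈ BDcClosure p μ := by
  classical
  have hp0 : 0 < p := one_pos.trans_le hp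
  induction s using Finset.induction_on with
  | empty =>
    simp only [Finset.sum_empty]
    exact ⟨const_mem_BD hp0 0, zero_mem_BDcClosure hp0⟩
  | insert i s hi ih =>
    simp only [Finset.sum_insert hi]
    obtain ⟨h1, h2⟩ := ih fun j hj => hf j (Finset.mem_insert_of_mem hj)
    obtain ⟨h3, h4⟩ := hf i (Finset.mem_insert_self i s)
    exact ⟨BD.add hp (BD.mul hp h3 h3) h1, BDcClosure.add hp (BDcClosure.mul hp h4 h3 h3) h2⟩

theorem mem_BD_of_lipschitzWith (hp : 0 < p) [IsFiniteMeasureOnCompacts μ] {K : ℝ≥0}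
    (hu : LipschitzWith K u) (hc : HasCompactSupport u) : u ∈ BD p μ := by
  obtain ⟨M, hM⟩ := hu.continuous.bounded_above_of_compact_support hc
  refine (mem_BD_iff hp).2 ⟨hu.continuous, ⟨M, hM⟩, (tsupport u).indicator fun _ => (K : ℝ≥0∞),
    isWeakUpperGradient_of_derivLE hp
      (measurable_const.indicator (isClosed_tsupport u).measurableSet)
      (.of_forall fun γ => γ.derivLE_of_lipschitzWith hu), ?_⟩
  have heq : (fun x => (tsupport u).indicator (fun _ => (K : ℝ≥0∞)) x ^ p) =
      (tsupport u).indicator fun _ => (K : ℝ≥0∞) ^ p := by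
    ext x
    by_cases hx : x ∈ tsupport u <;> simp [hx, ENNReal.zero_rpow_of_pos hp]
  rw [heq, lintegral_indicator_const (isClosed_tsupport u).measurableSet]
  exact ENNReal.mul_lt_top (ENNReal.rpow_lt_top_of_nonneg hp.le ENNReal.coe_ne_top)
    hc.isCompact.measure_lt_top

/-- A cone over a small ball inside a compact neighbourhood is Lipschitz with compact support. -/
theorem exists_mem_BDc_ne_zero (hp : 0 < p) [IsFiniteMeasureOnCompacts μ]
    [LocallyCompactSpace X] (x : X) : ∃ φ ∈ BDc p μ, φ x ≠ 0 := by
  obtain ⟨K, hK, hKx⟩ := exists_compact_mem_nhds x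
  obtain ⟨r, hr, hrK⟩ := Metric.mem_nhds_iff.1 hKx
  have hlip : LipschitzWith 1 fun y => max (r - dist y x) 0 := by
    have h1 : LipschitzWith 1 fun y : X => r - dist y x := by
      simpa using (LipschitzWith.const r).sub (LipschitzWith.dist_left x)
    exact h1.max_const 0
  have hsupp : HasCompactSupport fun y => max (r - dist y x) 0 := by
    refine HasCompactSupport.intro hK fun y hy => max_eq_right ?_
    by_contra! h
    exact hy (hrK (Metric.mem_ball.2 (by linarith)))
  refine ⟨_, ⟨mem_BD_of_lipschitzWith hp hlip hsupp, hsupp⟩, ?_⟩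
  simp [hr.not_ge]

end Algebra

/-! ### Parabolicity and the harmonic boundary -/

section HarmonicBoundary

variable {X : Type*} [MetricSpace X] [MeasurableSpace X] [BorelSpace X] {p : ℝ} {μ : Measure X}

theorem harmonicBoundary_eq_empty_of_isParabolic [Nonempty X] (hp : 0 < p)
    (h : IsParabolic p μ) : harmonicBoundary p μ = ∅ := by
  refine eq_empty_iff_forall_notMem.2 fun z hz => ?_
  have h0 := hz.2 ⟨_, const_mem_BD hp 1⟩ h
  have h1 := (z ⟨_, const_mem_BD hp 1⟩).2.1
  rw [h0, ciInf_const] at h1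
  linarith

theorem isParabolic_of_harmonicBoundary_eq_empty (hp : 1 ≤ p) [IsFiniteMeasureOnCompacts μ]
    [LocallyCompactSpace X] [Nonempty X] (h : harmonicBoundary p μ = ∅) : IsParabolic p μ := by
  have hp0 : 0 < p := one_pos.trans_le hp
  have hne (z : RoydenProduct p μ) (hz : z ∈ roydenCompactification p μ) :
      ∃ u : BD p μ, u.1 ∈ BDcClosure p μ ∧ (z u : ℝ) ≠ 0 := by
    by_cases hzr : z ∈ range (evalMap p μ)
    · obtain ⟨x, rfl⟩ := hzr
      obtain ⟨φ, hφ, hφx⟩ := exists_mem_BDc_ne_zero (μ := μ) hp0 x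
      exact ⟨⟨φ, hφ.1⟩, BDc.subset_BDcClosure hp0 hφ, hφx⟩
    · by_contra! hcon
      exact eq_empty_iff_forall_notMem.1 h z ⟨⟨hz, hzr⟩, hcon⟩
  have : Nonempty (BD p μ) := ⟨⟨_, const_mem_BD hp0 0⟩⟩
  choose! U hU hUne using hne
  have hcont (u : BD p μ) : Continuous fun z : RoydenProduct p μ => (z u : ℝ) :=
    continuous_subtype_val.comp (continuous_apply u)
  have hcompact : IsCompact (roydenCompactification p μ) := isClosed_closure.isCompact
  obtain ⟨t, ht, hcover⟩ := hcompact.elim_nhds_subcover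
    (fun z => {y | (y (U z) : ℝ) ≠ 0})
    fun z hz => (isOpen_ne_fun (hcont (U z)) continuous_const).mem_nhds (hUne z hz)
  obtain ⟨x₀⟩ := ‹Nonempty X›
  have hmem (x : X) : evalMap p μ x ∈ roydenCompactification p μ :=
    subset_closure (mem_range_self x)
  -- The sum of squares extends continuously to the compactification through the coordinates; its
  -- minimum, positive by the cover, is the lower bound used to invert it on `X`.
  obtain ⟨z₀, hz₀, hmin⟩ := hcompact.exists_isMinOn ⟨_, hmem x₀⟩
    (f := fun z => ∑ i ∈ t, (z (U i) : ℝ) * (z (U i) : ℝ))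
    (continuous_finsetSum t fun i _ => (hcont (U i)).mul (hcont (U i))).continuousOn
  have hpos : 0 < ∑ i ∈ t, (z₀ (U i) : ℝ) * (z₀ (U i) : ℝ) := by
    obtain ⟨i, hi, hzi⟩ := mem_iUnion₂.1 (hcover hz₀)
    exact Finset.sum_pos' (fun _ _ => mul_self_nonneg _) ⟨i, hi, mul_self_pos.2 hzi⟩
  obtain ⟨hwB, hwC⟩ := sum_mul_self_mem (μ := μ) hp t (f := fun i => (U i).1)
    fun i hi => ⟨(U i).2, hU i (ht i hi)⟩
  have hle (x : X) := isMinOn_iff.1 hmin _ (hmem x)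
  have hone := BDcClosure.mul hp hwC hwB (BD.inv hp0 hwB hpos hle)
  rw [IsParabolic]
  convert hone using 2 with x
  exact (mul_inv_cancel₀ (hpos.trans_le (hle x)).ne').symm

end HarmonicBoundary

end PRoyden

theorem corollary3p3 {X : Type*} [MetricSpace X] [CompleteSpace X] [LocallyCompactSpace X]
    [NoncompactSpace X] [MeasurableSpace X] [BorelSpace X] (μ : MeasureTheory.Measure X)
    (hball : ∀ (x : X) (r : ℝ), 0 < r →
      0 < μ (Metric.ball x r) ∧ μ (Metric.ball x r) < ⊤)
    (hdoubling : PRoyden.IsDoubling μ)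
    (p : ℝ) (hp : 1 < p) (hpoincare : PRoyden.PoincareInequality 1 p μ) :
    PRoyden.IsParabolic p μ ↔ PRoyden.harmonicBoundary p μ = ∅ := by
  have : IsLocallyFiniteMeasure μ :=
    ⟨fun x => ⟨Metric.ball x 1, Metric.ball_mem_nhds x one_pos, (hball x 1 one_pos).2⟩⟩
  -- An empty space would be compact.
  have : Nonempty X := not_isEmpty_iff.1 fun _ => not_compactSpace_iff.2 ‹_› inferInstance
  exact ⟨PRoyden.harmonicBoundary_eq_empty_of_isParabolic (one_pos.trans hp),
    PRoyden.isParabolic_of_harmonicBoundary_eq_empty hp.le⟩
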